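/- **Proposition 1.3.** Let $d\ge 5$ and let $(S_k)_{k\ge 0}$ be the nearest-neighbour symmetric random walk on $\mathbb{Z}^d$ started at $S_0=0$ (each step is uniform among the $2d$ unit vectors $\pm e_i$), with law $\mathbb{P}_0$ and expectation $\mathbb{E}_0$. For $x\in\mathbb{Z}^d$ let $l_n(x)=\sum_{k=0}^n \mathbf 1\{S_k=x\}$, $l_\infty(x)=\sum_{k\ge 0}\mathbf 1\{S_k=x\}$ and $G_d(x)=\mathbb{E}_0[l_\infty(x)]$. For every real $y>1+2\sum_{x\in\mathbb{Z}^d}G_d(x)^2$ there are constants $\bar c,\underline c>0$, depending only on $d$ and $y$, such that $$\mathbb{P}_0\Big(\sum_{x\in\mathbb{Z}^d} l_n(x)^2\ge ny\Big)\le \exp(-\bar c\sqrt n)\quad\text{for every integer } n\ge 0,$$ and $$\mathbb{P}_0\Big(\sum_{x\in\mathbb{Z}^d} l_n(x)^2\ge ny\Big)\ge \exp(-\underline c\sqrt n)\quad\text{for all sufficiently large integers } n.$$ -/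

import Mathlib

open MeasureTheory Filter

open scoped ENNReal

noncomputable section

namespace SRW

/-- The lattice `ℤ^d`. -/
abbrev Lattice (d : ℕ) : Type := Fin d → ℤ

/-- The law of one step of the nearest-neighbour symmetric walk on `ℤ^d`: each of the `2 d` unit
vectors `± e_i` has mass `1 / (2 d)`. -/
def stepLaw (d : ℕ) : Measure (Lattice d) :=
  (2 * (d : ℝ≥0∞))⁻¹ •
    ∑ i : Fin d, (Measure.dirac (Pi.single i (1 : ℤ)) + Measure.dirac (Pi.single i (-1 : ℤ)))

/-- The law of the sequence of i.i.d. steps of the walk, on the space of step sequences. -/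
def walkMeasure (d : ℕ) : Measure (ℕ → Lattice d) :=
  Measure.infinitePi fun _ : ℕ => stepLaw d

/-- The position `S_k` of the walk at time `k`; in particular `S_0 = 0`. -/
def pos {d : ℕ} (k : ℕ) (ω : ℕ → Lattice d) : Lattice d :=
  ∑ i ∈ Finset.range k, ω i

/-- The local time `l_n(x)`: the number of times `k ∈ {0, …, n}` with `S_k = x`. -/
def localTime {d : ℕ} (n : ℕ) (x : Lattice d) (ω : ℕ → Lattice d) : ℕ :=
  ((Finset.range (n + 1)).filter fun k => pos k ω = x).card

/-- The total local time `l_∞(x)`: the number, possibly infinite, of `k ≥ 0` with `S_k = x`. -/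
def totalLocalTime {d : ℕ} (x : Lattice d) (ω : ℕ → Lattice d) : ℝ≥0∞ :=
  ∑' k : ℕ, if pos k ω = x then 1 else 0

/-- The Green kernel `G_d(x)`, the expectation of `l_∞(x)`, as an element of `[0, ∞]`. -/
def green (d : ℕ) (x : Lattice d) : ℝ≥0∞ :=
  ∫⁻ ω, totalLocalTime x ω ∂(walkMeasure d)

/-- The self-intersection local time `∑_x l_n(x)^2`. Only finitely many terms are nonzero, see
`finite_support_localTime_sq`. -/
def silt {d : ℕ} (n : ℕ) (ω : ℕ → Lattice d) : ℕ :=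
  ∑ᶠ x : Lattice d, localTime n x ω ^ 2

theorem finite_support_localTime_sq {d : ℕ} (n : ℕ) (ω : ℕ → Lattice d) :
    (Function.support fun x : Lattice d => localTime n x ω ^ 2).Finite := by
  refine ((Finset.range (n + 1)).image fun k => pos k ω).finite_toSet.subset ?_
  intro x hx
  have h : localTime n x ω ≠ 0 := fun h0 => hx (by simp [h0])
  obtain ⟨k, hk⟩ := Finset.card_ne_zero.mp h
  rw [Finset.mem_filter] at hk
  exact Finset.mem_coe.mpr (Finset.mem_image.mpr ⟨k, hk.1, hk.2⟩)

theorem isProbabilityMeasure_stepLaw {d : ℕ} (hd : d ≠ 0) :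
    IsProbabilityMeasure (stepLaw d) := by
  constructor
  have h : (2 * (d : ℝ≥0∞)) ≠ 0 := by simp [hd]
  have h' : (2 * (d : ℝ≥0∞)) ≠ ∞ := ENNReal.mul_ne_top (by simp) (by simp)
  have h2 : (d : ℝ≥0∞) * (1 + 1) = 2 * d := by ring
  simp only [stepLaw, Measure.smul_apply, Measure.finsetSum_apply, Measure.add_apply,
    measure_univ, Finset.sum_const, Finset.card_univ, Fintype.card_fin, smul_eq_mul,
    nsmul_eq_mul, h2]
  exact ENNReal.inv_mul_cancel h h'

theorem isProbabilityMeasure_walkMeasure {d : ℕ} (hd : d ≠ 0) :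
    IsProbabilityMeasure (walkMeasure d) := by
  have := isProbabilityMeasure_stepLaw hd
  unfold walkMeasure
  infer_instance

end SRW

end

namespace SRW

noncomputable section

variable {d : ℕ}

/-! ### The Markov property -/

/-! Upper bound. Take `b` of order `√n` with `n + 1 ≤ b²` and cut time into `b` blocks of length
`b`. Twice the pairs inside blocks plus twice the pairs between a block and its past dominate `silt
n` (`sum_card_filter_pos_le`). Every exponential moment comes from one Khas'minskii-type estimate,
`lintegral_prod_one_add_le`, and the Markov property multiplies these moments over blocks
(`lintegral_prod_blocks_le`).

Inside a block, each time is followed by about `G_d(0)` returns, with exponential tails; exceeding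
`G_d(0) b²` by a fixed fraction of `b²` in total costs `exp(-c b)`
(`exists_measure_sum_blockPairs_le`). Between blocks, given the past, the intersections form an
additive functional of the new block whose potential is `∑ k, G_d(S_k - x)`. This sum is itself an
additive functional, with potential at most `∑ G_d²`, so it has exponential tails and exceeds `b /
64` somewhere only with probability polynomial times `exp(-c b)` (`measure_not_potentialBound_le`).
Off that event the cross terms reach `b² / 8` with probability at most `exp(-b / 2)`
(`measure_sum_crossPairs_le`).

Lower bound. Oscillating between `0` and a neighbour for order `√n` steps already produces `l_n(0)²
≥ n y`, at a cost exponential in `√n` (`eventually_le_measure_silt_ge`). -/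

instance [NeZero d] : IsProbabilityMeasure (stepLaw d) :=
  isProbabilityMeasure_stepLaw (NeZero.ne d)

instance [NeZero d] : IsProbabilityMeasure (walkMeasure d) :=
  isProbabilityMeasure_walkMeasure (NeZero.ne d)

/-- The first `m` steps of `ω`, followed by the steps of `ω'`. -/
def concat (m : ℕ) (ω ω' : ℕ → Lattice d) : ℕ → Lattice d :=
  fun i => if i < m then ω i else ω' (i - m)

theorem measurable_pos (k : ℕ) : Measurable (pos k : (ℕ → Lattice d) → Lattice d) := by
  unfold pos
  fun_prop

theorem measurable_concat (m : ℕ) :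
    Measurable fun p : (ℕ → Lattice d) × (ℕ → Lattice d) => concat m p.1 p.2 := by
  refine measurable_pi_lambda _ fun i => ?_
  unfold concat
  split_ifs <;> fun_prop

theorem measurable_concat_right (m : ℕ) (ω : ℕ → Lattice d) : Measurable (concat m ω) :=
  (measurable_concat m).comp measurable_prodMk_left

theorem pos_zero (ω : ℕ → Lattice d) : pos 0 ω = 0 := by simp [pos]

theorem pos_one (ω : ℕ → Lattice d) : pos 1 ω = ω 0 := by simp [pos]

theorem pos_concat_of_le {m k : ℕ} (h : k ≤ m) (ω ω' : ℕ → Lattice d) :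
    pos k (concat m ω ω') = pos k ω :=
  Finset.sum_congr rfl fun _ hi => if_pos ((Finset.mem_range.1 hi).trans_le h)

theorem pos_add_concat (m k : ℕ) (ω ω' : ℕ → Lattice d) :
    pos (m + k) (concat m ω ω') = pos m ω + pos k ω' := by
  rw [pos, Finset.sum_range_add]
  congr 1
  · exact pos_concat_of_le le_rfl ω ω'
  · exact Finset.sum_congr rfl fun i _ => by simp [concat]

/-- The Markov property at time `m`: replacing the steps after `m` by an independent copy preserves
the law. It suffices to compare finite cylinders, whose mass factors over indices below and above
`m`. -/
theorem map_concat_prod [NeZero d] (m : ℕ) :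
    ((walkMeasure d).prod (walkMeasure d)).map (fun p => concat m p.1 p.2) = walkMeasure d := by
  refine Measure.eq_infinitePi _ fun s t ht => ?_
  have hst : MeasurableSet ((s : Set ℕ).pi t) :=
    MeasurableSet.pi s.countable_toSet fun i _ => ht i
  rw [Measure.map_apply (measurable_concat m) hst]
  have hpre : (fun p : (ℕ → Lattice d) × (ℕ → Lattice d) => concat m p.1 p.2) ⁻¹'
      ((s : Set ℕ).pi t) =
      ((s.filter (· < m) : Finset ℕ) : Set ℕ).pi t ×ˢ
      (((s.filter (¬ · < m)).image (· - m) : Finset ℕ) : Set ℕ).pi (fun i => t (i + m)) := by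
    ext ⟨ω, ω'⟩
    simp only [Set.mem_preimage, Set.mem_pi, Finset.mem_coe, Set.mem_prod, Finset.mem_filter,
      Finset.mem_image, concat]
    constructor
    · intro h
      refine ⟨fun i hi => by simpa [hi.2] using h i hi.1, ?_⟩
      rintro _ ⟨i, ⟨hi, him⟩, rfl⟩
      have := h i hi
      rw [if_neg him] at this
      rwa [Nat.sub_add_cancel (not_lt.1 him)]
    · rintro ⟨h1, h2⟩ i hi
      by_cases him : i < m
      · simpa [him] using h1 i ⟨hi, him⟩
      · have := h2 (i - m) ⟨i, ⟨hi, him⟩, rfl⟩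
        rw [Nat.sub_add_cancel (not_lt.1 him)] at this
        simpa [him] using this
  rw [hpre, Measure.prod_prod, walkMeasure, Measure.infinitePi_pi _ (fun i _ => ht i),
    Measure.infinitePi_pi _ (fun i _ => ht (i + m)), Finset.prod_image,
    ← Finset.prod_filter_mul_prod_filter_not s (· < m)]
  · congr 1
    refine Finset.prod_congr rfl fun i hi => ?_
    rw [Nat.sub_add_cancel (not_lt.1 (Finset.mem_filter.1 hi).2)]
  · intro i hi j hj hij
    have hi' := (Finset.mem_filter.1 hi).2
    have hj' := (Finset.mem_filter.1 hj).2
    simp only at hij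
    omega

theorem lintegral_concat [NeZero d] (m : ℕ) {F : (ℕ → Lattice d) → ℝ≥0∞} (hF : Measurable F) :
    ∫⁻ ω, F ω ∂walkMeasure d =
      ∫⁻ ω, ∫⁻ ω', F (concat m ω ω') ∂walkMeasure d ∂walkMeasure d := by
  conv_lhs => rw [← map_concat_prod m]
  rw [lintegral_map hF (measurable_concat m)]
  exact lintegral_prod _ (hF.comp (measurable_concat m)).aemeasurable

/-- If, conditionally on the first `j * b` steps, each factor `W j` has mean at most `ρ`, and each
`W j` depends on the first `(j + 1) * b` steps only, then `∏ j < N, W j` has mean at most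
`ρ ^ N`. -/
theorem lintegral_prod_blocks_le [NeZero d] (b : ℕ) (W : ℕ → (ℕ → Lattice d) → ℝ≥0∞)
    (hm : ∀ j, Measurable (W j))
    (hdep : ∀ i j ω ω', i < j → W i (concat (j * b) ω ω') = W i ω) (ρ : ℝ≥0∞)
    (hρ : ∀ j ω, ∫⁻ ω', W j (concat (j * b) ω ω') ∂walkMeasure d ≤ ρ) (N : ℕ) :
    ∫⁻ ω, ∏ j ∈ Finset.range N, W j ω ∂walkMeasure d ≤ ρ ^ N := by
  induction N with
  | zero => simp
  | succ N ih =>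
    have hP : ∀ N, Measurable fun ω => ∏ j ∈ Finset.range N, W j ω := fun N =>
      Finset.measurable_prod _ fun j _ => hm j
    rw [lintegral_concat (N * b) (hP _)]
    calc _ = ∫⁻ ω, (∏ j ∈ Finset.range N, W j ω) *
          ∫⁻ ω', W N (concat (N * b) ω ω') ∂walkMeasure d ∂walkMeasure d := by
          refine lintegral_congr fun ω => ?_
          have hmN : Measurable fun ω' => W N (concat (N * b) ω ω') :=
            (hm N).comp (measurable_concat_right _ ω)
          rw [← lintegral_const_mul _ hmN]
          refine lintegral_congr fun ω' => ?_
          rw [Finset.prod_range_succ]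
          congr 1
          exact Finset.prod_congr rfl fun j hj => hdep _ _ _ _ (Finset.mem_range.1 hj)
      _ ≤ ∫⁻ ω, (∏ j ∈ Finset.range N, W j ω) * ρ ∂walkMeasure d :=
          lintegral_mono fun ω => mul_le_mul_right (hρ N ω) _
      _ = (∫⁻ ω, ∏ j ∈ Finset.range N, W j ω ∂walkMeasure d) * ρ :=
          lintegral_mul_const _ (hP N)
      _ ≤ ρ ^ (N + 1) := by
          rw [pow_succ]
          exact mul_le_mul_left ih _

/-! ### Potentials and exponential moments of additive functionals -/

/-- The potential `∑ k, E[g (x + S_k)]` of a nonnegative function `g`. -/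
def potential (g : Lattice d → ℝ≥0∞) (x : Lattice d) : ℝ≥0∞ :=
  ∑' k : ℕ, ∫⁻ ω, g (x + pos k ω) ∂walkMeasure d

theorem measurable_comp_pos (g : Lattice d → ℝ≥0∞) (x : Lattice d) (k : ℕ) :
    Measurable fun ω : ℕ → Lattice d => g (x + pos k ω) :=
  (Measurable.of_discrete (f := fun z => g (x + z))).comp (measurable_pos k)

/-- First-step decomposition: isolate the time-zero term and apply the Markov property at time `1`
to the others. -/
theorem potential_eq [NeZero d] (g : Lattice d → ℝ≥0∞) (x : Lattice d) :
    potential g x = g x + ∫⁻ ω, potential g (x + ω 0) ∂walkMeasure d := by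
  have h : ∀ k, ∫⁻ ω, g (x + pos (k + 1) ω) ∂walkMeasure d =
      ∫⁻ ω, ∫⁻ ω', g (x + ω 0 + pos k ω') ∂walkMeasure d ∂walkMeasure d := fun k => by
    rw [lintegral_concat 1 (measurable_comp_pos g x (k + 1))]
    simp_rw [add_comm k 1, pos_add_concat, pos_one, add_assoc]
  have hm : ∀ k, Measurable fun ω : ℕ → Lattice d =>
      ∫⁻ ω', g (x + ω 0 + pos k ω') ∂walkMeasure d := fun k =>
    (Measurable.of_discrete (f := fun z => ∫⁻ ω', g (x + z + pos k ω') ∂walkMeasure d)).comp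
      (measurable_pi_apply 0)
  rw [potential, tsum_eq_zero_add' ENNReal.summable]
  simp only [pos_zero, add_zero, lintegral_const, measure_univ, mul_one]
  simp_rw [h, potential]
  rw [lintegral_tsum fun k => (hm k).aemeasurable]

/-- A Khas'minskii-type bound: `u = 1 + a * potential g` is a supersolution. If `q` is the mean
potential after one step, then `(1 + g) (1 + a q) ≤ 1 + a (g + q)` as soon as `1 + a q ≤ a`, which
matters only where `g ≠ 0`. Hence the potential need only be controlled on the support of `g`. -/
theorem lintegral_prod_one_add_le [NeZero d] (g : Lattice d → ℝ≥0∞) (a : ℝ≥0∞)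
    (h : ∀ x, g x ≠ 0 → 1 + a * potential g x ≤ a) (n : ℕ) (x : Lattice d) :
    ∫⁻ ω, ∏ k ∈ Finset.range n, (1 + g (x + pos k ω)) ∂walkMeasure d ≤
      1 + a * potential g x := by
  induction n generalizing x with
  | zero => simp
  | succ n ih =>
    have hP : ∀ n (x : Lattice d), Measurable fun ω : ℕ → Lattice d =>
        ∏ k ∈ Finset.range n, (1 + g (x + pos k ω)) := fun n x =>
      Finset.measurable_prod _ fun k _ => (measurable_comp_pos g x k).const_add 1
    have hpot : Measurable fun ω : ℕ → Lattice d => potential g (x + ω 0) :=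
      (Measurable.of_discrete (f := fun z => potential g (x + z))).comp (measurable_pi_apply 0)
    set q := ∫⁻ ω, potential g (x + ω 0) ∂walkMeasure d with hq
    have hx : potential g x = g x + q := potential_eq g x
    calc _ = ∫⁻ ω, (1 + g x) * ∫⁻ ω', ∏ k ∈ Finset.range n, (1 + g (x + ω 0 + pos k ω'))
          ∂walkMeasure d ∂walkMeasure d := by
          rw [lintegral_concat 1 (hP _ x)]
          refine lintegral_congr fun ω => ?_
          rw [← lintegral_const_mul _ (hP _ _)]
          refine lintegral_congr fun ω' => ?_
          rw [Finset.prod_range_succ', mul_comm]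
          simp_rw [add_comm _ 1, pos_add_concat, pos_one, pos_zero, add_zero, add_assoc]
      _ ≤ ∫⁻ ω, (1 + g x) * (1 + a * potential g (x + ω 0)) ∂walkMeasure d :=
          lintegral_mono fun ω => mul_le_mul_right (ih _) _
      _ = (1 + g x) * (1 + a * q) := by
          rw [lintegral_const_mul _ ((hpot.const_mul a).const_add 1),
            lintegral_add_left measurable_const, lintegral_const_mul _ hpot]
          simp [hq]
      _ ≤ 1 + a * potential g x := by
          by_cases hg : g x = 0
          · simp [hx, hg]
          · have h1 : 1 + a * q ≤ a := le_trans (by rw [hx]; gcongr; exact le_add_self) (h x hg)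
            calc (1 + g x) * (1 + a * q) = 1 + a * q + g x * (1 + a * q) := by ring
              _ ≤ 1 + a * q + g x * a := by gcongr
              _ = 1 + a * potential g x := by rw [hx]; ring

theorem green_eq_tsum (x : Lattice d) :
    green d x = ∑' k : ℕ, ∫⁻ ω, (if pos k ω = x then 1 else 0) ∂walkMeasure d := by
  unfold green totalLocalTime
  refine lintegral_tsum fun k => ?_
  exact ((Measurable.of_discrete (f := fun z : Lattice d => if z = x then (1 : ℝ≥0∞) else 0)).comp
    (measurable_pos k)).aemeasurable

theorem potential_eq_tsum_green (g : Lattice d → ℝ≥0∞) (x : Lattice d) :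
    potential g x = ∑' z, g (x + z) * green d z := by
  simp_rw [green_eq_tsum, ← ENNReal.tsum_mul_left]
  rw [ENNReal.tsum_comm]
  refine tsum_congr fun k => ?_
  have hm : ∀ z : Lattice d, Measurable fun ω : ℕ → Lattice d =>
      if pos k ω = z then (1 : ℝ≥0∞) else 0 := fun z =>
    (Measurable.of_discrete (f := fun y : Lattice d => if y = z then (1 : ℝ≥0∞) else 0)).comp
      (measurable_pos k)
  simp_rw [← lintegral_const_mul _ (hm _)]
  rw [← lintegral_tsum fun z => ((hm z).const_mul _).aemeasurable]
  refine lintegral_congr fun ω => ?_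
  rw [tsum_eq_single (pos k ω) fun z hz => by simp [hz.symm]]
  simp

theorem potential_const_mul (c : ℝ≥0∞) (g : Lattice d → ℝ≥0∞) (x : Lattice d) :
    potential (fun z => c * g z) x = c * potential g x := by
  simp_rw [potential_eq_tsum_green, mul_assoc, ENNReal.tsum_mul_left]

theorem potential_finset_sum {ι : Type*} (s : Finset ι) (g : ι → Lattice d → ℝ≥0∞)
    (x : Lattice d) :
    potential (fun z => ∑ i ∈ s, g i z) x = ∑ i ∈ s, potential (g i) x := by
  simp_rw [potential_eq_tsum_green, Finset.sum_mul]
  exact Summable.tsum_finsetSum fun i _ => ENNReal.summable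

theorem potential_single (y x : Lattice d) :
    potential (fun z => if z = y then 1 else 0) x = green d (y - x) := by
  rw [potential_eq_tsum_green, tsum_eq_single (y - x)]
  · simp
  · intro z hz
    have : x + z ≠ y := fun h => hz (by rw [← h]; abel)
    simp [this]

/-- The inequality `a b ≤ (a² + b²) / 2` and translation invariance of the sum over the lattice
suffice; no symmetry of the Green kernel is needed. -/
theorem potential_green_sub_le (y x : Lattice d) :
    potential (fun z => green d (z - y)) x ≤ ∑' z, green d z ^ 2 := by
  have hab : ∀ a b : ℝ≥0∞, a * b ≤ 2⁻¹ * a ^ 2 + 2⁻¹ * b ^ 2 := fun a b => by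
    have h2 : 2 * (a * b) ≤ a ^ 2 + b ^ 2 := by
      by_cases ha : a = ∞
      · simp [ha]
      by_cases hb : b = ∞
      · simp [hb]
      lift a to NNReal using ha
      lift b to NNReal using hb
      norm_cast
      rw [← NNReal.coe_le_coe]
      push_cast
      nlinarith [sq_nonneg ((a : ℝ) - b)]
    calc a * b = 2⁻¹ * (2 * (a * b)) := by
          rw [← mul_assoc, ENNReal.inv_mul_cancel (by simp) (by simp), one_mul]
      _ ≤ 2⁻¹ * (a ^ 2 + b ^ 2) := by gcongr
      _ = _ := mul_add _ _ _
  rw [potential_eq_tsum_green]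
  calc _ ≤ ∑' z, (2⁻¹ * green d (x + z - y) ^ 2 + 2⁻¹ * green d z ^ 2) :=
        ENNReal.tsum_le_tsum fun z => hab _ _
    _ = 2⁻¹ * (∑' z, green d z ^ 2) + 2⁻¹ * ∑' z, green d z ^ 2 := by
        rw [ENNReal.tsum_add, ENNReal.tsum_mul_left, ENNReal.tsum_mul_left]
        congr 2
        rw [← (Equiv.addLeft (x - y)).tsum_eq fun z => green d z ^ 2]
        refine tsum_congr fun z => ?_
        simp only [Equiv.coe_addLeft]
        congr 2
        abel
    _ = _ := by rw [← add_mul, ENNReal.inv_two_add_inv_two, one_mul]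

theorem one_le_green_zero [NeZero d] : 1 ≤ green d 0 := by
  rw [green_eq_tsum]
  refine le_trans ?_ (ENNReal.le_tsum 0)
  simp [pos_zero]

/-- A value at least `1` is below its own square; a value below `1` is dominated by the term
`G_d(0)² ≥ 1`. -/
theorem green_le_tsum_sq [NeZero d] (x : Lattice d) : green d x ≤ ∑' z, green d z ^ 2 := by
  rcases le_total 1 (green d x) with h | h
  · refine le_trans ?_ (ENNReal.le_tsum x)
    rw [sq]
    exact le_mul_of_one_le_left zero_le h
  · refine h.trans (le_trans ?_ (ENNReal.le_tsum (0 : Lattice d)))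
    exact one_le_pow₀ one_le_green_zero

/-- Since `exp t ≤ 1 + t + t² ≤ 1 + 2 t` on `[0, 1]`, exponentials of additive functionals reduce to
the products bounded by `lintegral_prod_one_add_le`. -/
theorem ofReal_exp_sum_toReal_le {ι : Type*} (s : Finset ι) (F : ι → ℝ≥0∞)
    (hF : ∀ i ∈ s, F i ≤ 1) :
    ENNReal.ofReal (Real.exp (∑ i ∈ s, F i).toReal) ≤ ∏ i ∈ s, (1 + 2 * F i) := by
  rw [ENNReal.toReal_sum fun i hi => ne_top_of_le_ne_top ENNReal.one_ne_top (hF i hi),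
    Real.exp_sum, ENNReal.ofReal_prod_of_nonneg fun i _ => (Real.exp_pos _).le]
  refine Finset.prod_le_prod' fun i hi => ?_
  have hfin := ne_top_of_le_ne_top ENNReal.one_ne_top (hF i hi)
  have h1 : (F i).toReal ≤ 1 := ENNReal.toReal_le_of_le_ofReal zero_le_one (by simpa using hF i hi)
  have h0 : 0 ≤ (F i).toReal := ENNReal.toReal_nonneg
  have h2 := (abs_le.1 (Real.abs_exp_sub_one_sub_id_le (abs_le.2 ⟨by linarith, h1⟩))).2
  refine ENNReal.ofReal_le_of_le_toReal ?_
  rw [ENNReal.toReal_add (by simp) (ENNReal.mul_ne_top (by simp) hfin), ENNReal.toReal_mul]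
  simp only [ENNReal.toReal_one, ENNReal.toReal_ofNat]
  nlinarith

theorem measure_ofReal_exp_le_le {Ω : Type*} [MeasurableSpace Ω] {μ : Measure Ω} {Z : Ω → ℝ≥0∞}
    (hZ : Measurable Z) (T : ℝ) :
    μ {ω | ENNReal.ofReal (Real.exp T) ≤ Z ω} ≤
      ENNReal.ofReal (Real.exp (-T)) * ∫⁻ ω, Z ω ∂μ := by
  have h := mul_meas_ge_le_lintegral (μ := μ) hZ (ENNReal.ofReal (Real.exp T))
  calc _ = ENNReal.ofReal (Real.exp (-T)) * (ENNReal.ofReal (Real.exp T) *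
        μ {ω | ENNReal.ofReal (Real.exp T) ≤ Z ω}) := by
        rw [← mul_assoc, ← ENNReal.ofReal_mul (Real.exp_pos _).le, ← Real.exp_add]
        simp
    _ ≤ _ := by gcongr

/-! ### Self-intersections inside a block -/

theorem measurable_card_filter_pos (s : Finset ℕ) (u v : ℕ → ℕ) :
    Measurable fun ω : ℕ → Lattice d => (s.filter fun k => pos (u k) ω = pos (v k) ω).card := by
  simp_rw [Finset.card_filter]
  refine Finset.measurable_sum _ fun k _ => ?_
  exact (Measurable.of_discrete (f := fun z : Lattice d × Lattice d => if z.1 = z.2 then 1 else 0)).comp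
    ((measurable_pos (u k)).prodMk (measurable_pos (v k)))

theorem lintegral_exp_visits_zero_le [NeZero d] {c : ℝ} (hc0 : 0 ≤ c) (hc1 : c ≤ 1) (a : ℝ≥0∞)
    (ha : 1 + a * (ENNReal.ofReal (c * (1 + c)) * green d 0) ≤ a) (n : ℕ) :
    ∫⁻ ω : ℕ → Lattice d, ENNReal.ofReal (Real.exp (c *
        (((Finset.range n).filter fun s => pos s ω = 0).card : ℝ))) ∂walkMeasure d ≤
      1 + a * (ENNReal.ofReal (c * (1 + c)) * green d 0) := by
  -- The weight `c + c²` bounds `exp c - 1` to second order; the cruder `2 c` would lose the leading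
  -- constant `G_d(0)` in the exponential rate.
  set g : Lattice d → ℝ≥0∞ := fun z => ENNReal.ofReal (c * (1 + c)) * if z = 0 then 1 else 0
    with hg
  have hpot : potential g 0 = ENNReal.ofReal (c * (1 + c)) * green d 0 := by
    rw [hg, potential_const_mul, potential_single, sub_zero]
  have key := lintegral_prod_one_add_le g a (fun x hx => by
    have : x = 0 := by
      by_contra h
      simp [hg, h] at hx
    rw [this, hpot]
    exact ha) n 0
  rw [hpot] at key
  refine le_trans (lintegral_mono fun ω => ?_) key
  rw [Finset.card_filter, Nat.cast_sum, Finset.mul_sum, Real.exp_sum,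
    ENNReal.ofReal_prod_of_nonneg fun i _ => (Real.exp_pos _).le]
  refine Finset.prod_le_prod' fun i _ => ?_
  by_cases h : pos i ω = 0
  · have h2 := (abs_le.1 (Real.abs_exp_sub_one_sub_id_le (abs_le.2 ⟨by linarith, hc1⟩))).2
    simp only [h, hg, if_true, Nat.cast_one, mul_one, add_zero]
    rw [← ENNReal.ofReal_one, ← ENNReal.ofReal_add zero_le_one (by positivity)]
    exact ENNReal.ofReal_le_ofReal (by nlinarith)
  · simp [h, hg]

theorem exists_lintegral_exp_visits_zero_le [NeZero d] (hfin : green d 0 ≠ ∞) :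
    ∃ c : ℝ, 0 < c ∧ ∀ n, ∫⁻ ω : ℕ → Lattice d, ENNReal.ofReal (Real.exp (c *
        (((Finset.range n).filter fun s => pos s ω = 0).card : ℝ))) ∂walkMeasure d ≤
      ENNReal.ofReal (Real.exp (c * ((green d 0).toReal + 1 / 16))) := by
  set G := (green d 0).toReal with hG
  have hG1 : 1 ≤ G := by
    have := (ENNReal.toReal_le_toReal ENNReal.one_ne_top hfin).2 (one_le_green_zero (d := d))
    simpa using this
  have hGo : green d 0 = ENNReal.ofReal G := (ENNReal.ofReal_toReal hfin).symm
  -- With `a = 1 + η`, the criterion reads `(1 + η) c (1 + c) G ≤ η`, which `c G = η / 4` ensures.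
  -- The excess over `G` in the rate is at most `η G + 2 c G = 1 / 64 + η / 2`, below `1 / 16`.
  set η : ℝ := 1 / (64 * G) with hη
  set c : ℝ := η / (4 * G) with hc
  have hηG : η * G = 1 / 64 := by rw [hη]; field_simp
  have hcG : c * G = η / 4 := by rw [hc]; field_simp
  have hη0 : 0 < η := by positivity
  have hc0 : 0 < c := by positivity
  have hη1 : η ≤ 1 / 64 := by nlinarith
  have hc1 : c ≤ 1 / 256 := by nlinarith
  have hrw : ENNReal.ofReal (1 + η) * (ENNReal.ofReal (c * (1 + c)) * green d 0) =
      ENNReal.ofReal ((1 + η) * (c * (1 + c) * G)) := by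
    rw [hGo, ← ENNReal.ofReal_mul (by positivity), ← ENNReal.ofReal_mul (by positivity)]
  have hadd : ∀ t : ℝ, 0 ≤ t → 1 + ENNReal.ofReal t = ENNReal.ofReal (1 + t) := fun t ht => by
    rw [ENNReal.ofReal_add zero_le_one ht, ENNReal.ofReal_one]
  have hfac : (1 + η) * (1 + c) ≤ 1 + η + 2 * c := by nlinarith
  have hid : (1 + η) * (c * (1 + c) * G) = c * ((1 + η) * (1 + c) * G) := by ring
  have hb : (1 + η) * (1 + c) * G ≤ G + 1 / 16 := by nlinarith
  refine ⟨c, hc0, fun n => ?_⟩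
  refine (lintegral_exp_visits_zero_le hc0.le (by linarith) (ENNReal.ofReal (1 + η)) ?_ n).trans ?_
  · rw [hrw, hadd _ (by positivity)]
    refine ENNReal.ofReal_le_ofReal ?_
    rw [hid]
    nlinarith
  · rw [hrw, hadd _ (by positivity)]
    refine ENNReal.ofReal_le_ofReal ?_
    rw [hid, add_comm]
    exact (Real.add_one_le_exp _).trans (Real.exp_le_exp.2 (by gcongr))

/-- The number of pairs of times `t ≤ s` in the block `[j * b, (j + 1) * b)` with `S_s = S_t`. -/
def blockPairs (b j : ℕ) (ω : ℕ → Lattice d) : ℕ :=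
  ∑ t ∈ Finset.range b,
    ((Finset.range (b - t)).filter fun s => pos (j * b + (t + s)) ω = pos (j * b + t) ω).card

theorem measurable_blockPairs (b j : ℕ) :
    Measurable (blockPairs b j : (ℕ → Lattice d) → ℕ) :=
  Finset.measurable_sum _ fun _ _ => measurable_card_filter_pos _ _ _

theorem measurable_ofReal_exp_mul {f : (ℕ → Lattice d) → ℕ} (hf : Measurable f) (θ : ℝ) :
    Measurable fun ω => ENNReal.ofReal (Real.exp (θ * f ω)) :=
  (Measurable.of_discrete (f := fun n : ℕ => ENNReal.ofReal (Real.exp (θ * n)))).comp hf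

/-- The block count is the sum over `b` starting times of the later returns. Convexity of `exp`
averages over these times, so no independence between them is needed; each return count is handled
by the Markov property at its starting time. -/
theorem lintegral_exp_blockPairs_le [NeZero d] {c : ℝ} {ρ : ℝ≥0∞}
    (hc : ∀ n, ∫⁻ ω : ℕ → Lattice d, ENNReal.ofReal (Real.exp (c *
        (((Finset.range n).filter fun s => pos s ω = 0).card : ℝ))) ∂walkMeasure d ≤ ρ)
    {b : ℕ} (hb : 0 < b) :
    ∫⁻ ω : ℕ → Lattice d, ENNReal.ofReal (Real.exp (c / b * blockPairs b 0 ω))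
      ∂walkMeasure d ≤ ρ := by
  set V : ℕ → (ℕ → Lattice d) → ℕ := fun t ω =>
    ((Finset.range (b - t)).filter fun s => pos (t + s) ω = pos t ω).card with hV
  have hb' : (0 : ℝ) < b := by exact_mod_cast hb
  have hVm : ∀ t, Measurable fun ω => ENNReal.ofReal (Real.exp (c * V t ω)) := fun t =>
    measurable_ofReal_exp_mul (measurable_card_filter_pos _ _ _) c
  have hVi : ∀ t, ∫⁻ ω, ENNReal.ofReal (Real.exp (c * V t ω)) ∂walkMeasure d ≤ ρ := fun t => by
    rw [lintegral_concat t (hVm t)]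
    calc _ ≤ ∫⁻ _ω : ℕ → Lattice d, ρ ∂walkMeasure d := by
          refine lintegral_mono fun ω => le_trans (le_of_eq ?_) (hc (b - t))
          refine lintegral_congr fun ω' => ?_
          simp only [hV]
          simp_rw [pos_add_concat, pos_concat_of_le (le_refl t), add_eq_left]
      _ = ρ := by simp
  have hJ : ∀ ω, Real.exp (c / b * blockPairs b 0 ω) ≤
      ∑ t ∈ Finset.range b, (b : ℝ)⁻¹ * Real.exp (c * V t ω) := fun ω => by
    have h := convexOn_exp.map_sum_le (t := Finset.range b) (w := fun _ => (b : ℝ)⁻¹)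
      (p := fun t => c * V t ω) (fun _ _ => by positivity)
      (by simp [hb'.ne']) (fun _ _ => Set.mem_univ _)
    simp only [smul_eq_mul] at h
    refine le_trans (le_of_eq ?_) h
    congr 1
    simp only [blockPairs, zero_mul, zero_add, hV]
    push_cast
    rw [Finset.mul_sum]
    refine Finset.sum_congr rfl fun t _ => ?_
    field_simp
  calc _ ≤ ∫⁻ ω, ∑ t ∈ Finset.range b,
        ENNReal.ofReal (b : ℝ)⁻¹ * ENNReal.ofReal (Real.exp (c * V t ω)) ∂walkMeasure d := by
        refine lintegral_mono fun ω => (ENNReal.ofReal_le_ofReal (hJ ω)).trans (le_of_eq ?_)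
        rw [ENNReal.ofReal_sum_of_nonneg fun _ _ => by positivity]
        exact Finset.sum_congr rfl fun t _ => ENNReal.ofReal_mul (by positivity)
    _ = ∑ t ∈ Finset.range b, ENNReal.ofReal (b : ℝ)⁻¹ *
        ∫⁻ ω, ENNReal.ofReal (Real.exp (c * V t ω)) ∂walkMeasure d := by
        rw [lintegral_finsetSum _ fun t _ => (hVm t).const_mul _]
        exact Finset.sum_congr rfl fun t _ => lintegral_const_mul _ (hVm t)
    _ ≤ ∑ t ∈ Finset.range b, ENNReal.ofReal (b : ℝ)⁻¹ * ρ := by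
        gcongr with t _
        exact hVi t
    _ = ρ := by
        rw [Finset.sum_const, Finset.card_range, nsmul_eq_mul, ← mul_assoc,
          ENNReal.ofReal_inv_of_pos hb', ENNReal.ofReal_natCast,
          ENNReal.mul_inv_cancel (by exact_mod_cast hb.ne') (by simp), one_mul]

/-- Exponential Markov inequality at parameter `c / b`: the threshold `G + 1 / 8` against the moment
rate `G + 1 / 16` leaves a gain of `c / 16` per block. -/
theorem exists_measure_sum_blockPairs_le [NeZero d] (hfin : green d 0 ≠ ∞) :
    ∃ c : ℝ, 0 < c ∧ ∀ b : ℕ, 0 < b →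
      walkMeasure d {ω | ((green d 0).toReal + 1 / 8) * (b : ℝ) ^ 2 ≤
        ((∑ j ∈ Finset.range b, blockPairs b j ω : ℕ) : ℝ)} ≤
      ENNReal.ofReal (Real.exp (-(c * b))) := by
  obtain ⟨c, hc0, hc⟩ := exists_lintegral_exp_visits_zero_le hfin
  refine ⟨c / 16, by positivity, fun b hb => ?_⟩
  set G := (green d 0).toReal
  have hb' : (0 : ℝ) < b := by exact_mod_cast hb
  set W : ℕ → (ℕ → Lattice d) → ℝ≥0∞ := fun j ω =>
    ENNReal.ofReal (Real.exp (c / b * blockPairs b j ω)) with hW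
  have hWm : ∀ j, Measurable (W j) := fun j =>
    measurable_ofReal_exp_mul (measurable_blockPairs b j) _
  have hprod := lintegral_prod_blocks_le b W hWm (fun i j ω ω' hij => by
      have hle : (i + 1) * b ≤ j * b := Nat.mul_le_mul_right b hij
      rw [add_mul, one_mul] at hle
      have hbl : blockPairs b i (concat (j * b) ω ω') = blockPairs b i ω := by
        refine Finset.sum_congr rfl fun t ht => ?_
        have ht' := Finset.mem_range.1 ht
        congr 1
        refine Finset.filter_congr fun s hs => ?_
        have hs' := Finset.mem_range.1 hs
        rw [pos_concat_of_le (by omega), pos_concat_of_le (by omega)]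
      simp only [hW, hbl])
    (ENNReal.ofReal (Real.exp (c * (G + 1 / 16)))) (fun j ω => by
      refine le_trans (le_of_eq (lintegral_congr fun ω' => ?_)) (lintegral_exp_blockPairs_le hc hb)
      simp only [hW, blockPairs, pos_add_concat, zero_mul, zero_add, add_right_inj]) b
  calc _ ≤ walkMeasure d {ω | ENNReal.ofReal (Real.exp (c / b * ((G + 1 / 8) * (b : ℝ) ^ 2))) ≤
        ∏ j ∈ Finset.range b, W j ω} := by
        refine measure_mono fun ω hω => ?_
        simp only [Set.mem_ofPred_eq] at hω ⊢
        rw [← ENNReal.ofReal_prod_of_nonneg fun _ _ => (Real.exp_pos _).le, ← Real.exp_sum,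
          ← Finset.mul_sum, ← Nat.cast_sum]
        gcongr
    _ ≤ ENNReal.ofReal (Real.exp (-(c / b * ((G + 1 / 8) * (b : ℝ) ^ 2)))) *
        ENNReal.ofReal (Real.exp (c * (G + 1 / 16))) ^ b := by
        refine (measure_ofReal_exp_le_le (Finset.measurable_prod _ fun j _ => hWm j) _).trans ?_
        gcongr
    _ = _ := by
        rw [← ENNReal.ofReal_pow (Real.exp_pos _).le, ← Real.exp_nat_mul,
          ← ENNReal.ofReal_mul (Real.exp_pos _).le, ← Real.exp_add]
        congr 2
        field_simp
        ring

/-! ### Intersections between different blocks -/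

/-- The number of pairs of times `k < m ≤ s < m + b` with `S_s = S_k`. -/
def crossPairs (m b : ℕ) (ω : ℕ → Lattice d) : ℕ :=
  ∑ t ∈ Finset.range b, ((Finset.range m).filter fun k => pos k ω = pos (m + t) ω).card

/-- The potential of the local times before time `m` is at most `K` at each point visited by the
walk up to time `m`. -/
def PotentialBound (m : ℕ) (K : ℝ≥0∞) (ω : ℕ → Lattice d) : Prop :=
  ∀ i ≤ m, ∑ k ∈ Finset.range m, green d (pos k ω - pos i ω) ≤ K

theorem measurable_green_sub {f g : (ℕ → Lattice d) → Lattice d} (hf : Measurable f)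
    (hg : Measurable g) : Measurable fun ω => green d (f ω - g ω) :=
  (Measurable.of_discrete (f := fun z : Lattice d × Lattice d => green d (z.1 - z.2))).comp
    (hf.prodMk hg)

theorem measurableSet_potentialBound (m : ℕ) (K : ℝ≥0∞) :
    MeasurableSet {ω : ℕ → Lattice d | PotentialBound m K ω} := by
  simp only [PotentialBound, Set.ofPred_forall]
  refine MeasurableSet.iInter fun i => MeasurableSet.iInter fun _ => ?_
  exact measurableSet_le (Finset.measurable_sum _ fun k _ =>
    measurable_green_sub (measurable_pos k) (measurable_pos i)) measurable_const

theorem potentialBound_concat_iff {m n : ℕ} (h : m ≤ n) (K : ℝ≥0∞) (ω ω' : ℕ → Lattice d) :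
    PotentialBound m K (concat n ω ω') ↔ PotentialBound m K ω := by
  refine forall₂_congr fun i hi => ?_
  rw [pos_concat_of_le (hi.trans h)]
  rw [Finset.sum_congr rfl fun k hk => by
    rw [pos_concat_of_le ((Finset.mem_range.1 hk).le.trans h)]]

/-- With the past frozen, the cross pairs are the sum along the new block of `f`, the local time of
the past. `PotentialBound` is used at times `i < m` because these visit the support of `f`, and at
`i = m` because the new block starts there. -/
theorem lintegral_exp_crossPairs_le [NeZero d] {lam K : ℝ} (hlam : 0 ≤ lam)
    (hlK : lam * K ≤ 1 / 8) (m b : ℕ) (ω : ℕ → Lattice d)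
    (hω : PotentialBound m (ENNReal.ofReal K) ω) :
    ∫⁻ ω', ENNReal.ofReal (Real.exp (lam * crossPairs m b (concat m ω ω'))) ∂walkMeasure d ≤
      ENNReal.ofReal (3 / 2) := by
  set f : Lattice d → ℝ≥0∞ := fun z => ∑ k ∈ Finset.range m, if z = pos k ω then 1 else 0 with hf
  set g : Lattice d → ℝ≥0∞ := fun z => (2 * ENNReal.ofReal lam) * f z with hg
  have hpf : ∀ x, potential f x = ∑ k ∈ Finset.range m, green d (pos k ω - x) := fun x => by
    rw [hf, potential_finset_sum]
    exact Finset.sum_congr rfl fun k _ => potential_single _ _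
  have hlf : ∀ i ≤ m, ENNReal.ofReal lam * potential f (pos i ω) ≤ ENNReal.ofReal (1 / 8) :=
    fun i hi => by
      calc _ ≤ ENNReal.ofReal lam * ENNReal.ofReal K := by
            rw [hpf]
            gcongr
            exact hω i hi
        _ ≤ _ := by
            rw [← ENNReal.ofReal_mul hlam]
            exact ENNReal.ofReal_le_ofReal hlK
  have hpg : ∀ i ≤ m, 2 * potential g (pos i ω) ≤ ENNReal.ofReal (1 / 2) := fun i hi => by
    rw [hg, potential_const_mul]
    calc _ = 4 * (ENNReal.ofReal lam * potential f (pos i ω)) := by ring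
      _ ≤ 4 * ENNReal.ofReal (1 / 8) := by
          gcongr
          exact hlf i hi
      _ = _ := by
          rw [← ENNReal.ofReal_ofNat 4, ← ENNReal.ofReal_mul (by norm_num)]
          norm_num
  have hsupp : ∀ x, f x ≠ 0 → ∃ k < m, x = pos k ω := fun x hx => by
    obtain ⟨k, hk, hne⟩ := Finset.exists_ne_zero_of_sum_ne_zero hx
    exact ⟨k, Finset.mem_range.1 hk, by by_contra h; simp [h] at hne⟩
  have hone : (1 : ℝ≥0∞) + ENNReal.ofReal (1 / 2) = ENNReal.ofReal (3 / 2) := by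
    rw [← ENNReal.ofReal_one, ← ENNReal.ofReal_add (by norm_num) (by norm_num)]
    norm_num
  have key := lintegral_prod_one_add_le g 2 (fun x hx => by
    obtain ⟨k, hk, rfl⟩ := hsupp x fun h => hx (by simp [hg, h])
    calc _ ≤ (1 : ℝ≥0∞) + ENNReal.ofReal (1 / 2) := by
          gcongr
          exact hpg k hk.le
      _ ≤ 2 := by
          rw [hone, ← ENNReal.ofReal_ofNat 2]
          exact ENNReal.ofReal_le_ofReal (by norm_num)) b (pos m ω)
  calc _ ≤ ∫⁻ ω', ∏ t ∈ Finset.range b, (1 + g (pos m ω + pos t ω')) ∂walkMeasure d := by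
        refine lintegral_mono fun ω' => ?_
        have h1 := ofReal_exp_sum_toReal_le (Finset.range b)
          (fun t => ENNReal.ofReal lam * f (pos m ω + pos t ω')) (fun t _ => by
            by_cases h0 : f (pos m ω + pos t ω') = 0
            · simp [h0]
            obtain ⟨k, hk, hkx⟩ := hsupp _ h0
            rw [hkx]
            -- A function is at most its potential, so the potential bound also keeps each exponent
            -- at most `1`.
            calc _ ≤ ENNReal.ofReal lam * potential f (pos k ω) := by
                  gcongr
                  rw [potential_eq]
                  exact le_self_add
              _ ≤ ENNReal.ofReal (1 / 8) := hlf k hk.le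
              _ ≤ 1 := ENNReal.ofReal_le_one.2 (by norm_num))
        simp only [hg, mul_assoc]
        refine le_trans (le_of_eq ?_) h1
        congr 2
        rw [← Finset.mul_sum, ENNReal.toReal_mul, ENNReal.toReal_ofReal hlam]
        congr 1
        have : ∑ t ∈ Finset.range b, f (pos m ω + pos t ω') =
            ((crossPairs m b (concat m ω ω') : ℕ) : ℝ≥0∞) := by
          simp only [crossPairs, Finset.card_filter, hf]
          push_cast
          refine Finset.sum_congr rfl fun t _ => Finset.sum_congr rfl fun k hk => ?_
          rw [pos_add_concat, pos_concat_of_le (Finset.mem_range.1 hk).le]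
          simp only [eq_comm]
        rw [this, ENNReal.toReal_natCast]
    _ ≤ 1 + 2 * potential g (pos m ω) := key
    _ ≤ 1 + ENNReal.ofReal (1 / 2) := by
        gcongr
        exact hpg m le_rfl
    _ = _ := hone

theorem measurable_crossPairs (m b : ℕ) :
    Measurable (crossPairs m b : (ℕ → Lattice d) → ℕ) :=
  Finset.measurable_sum _ fun t _ => measurable_card_filter_pos _ (fun k => k) fun _ => m + t

/-- Each factor carries the indicator of the good event for its own past, so the conditional moment
bound `3 / 2` holds for every past. At parameter `8 / b`, reaching `b² / 8` costs `exp(-b)`, against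
a total moment `(3 / 2) ^ b ≤ exp(b / 2)`. -/
theorem measure_sum_crossPairs_le [NeZero d] {b : ℕ} (hb : 0 < b) :
    walkMeasure d {ω | (∀ j < b, PotentialBound (j * b) (ENNReal.ofReal (b / 64)) ω) ∧
        (b : ℝ) ^ 2 / 8 ≤ ((∑ j ∈ Finset.range b, crossPairs (j * b) b ω : ℕ) : ℝ)} ≤
      ENNReal.ofReal (Real.exp (-(1 / 2 * b))) := by
  classical
  have hb' : (0 : ℝ) < b := by exact_mod_cast hb
  set K : ℝ≥0∞ := ENNReal.ofReal (b / 64) with hK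
  set W : ℕ → (ℕ → Lattice d) → ℝ≥0∞ := fun j =>
    {ω | PotentialBound (j * b) K ω}.indicator fun ω =>
      ENNReal.ofReal (Real.exp (8 / b * crossPairs (j * b) b ω)) with hW
  have hWm : ∀ j, Measurable (W j) := fun j =>
    (measurable_ofReal_exp_mul (measurable_crossPairs _ _) _).indicator
      (measurableSet_potentialBound _ _)
  have hprod := lintegral_prod_blocks_le b W hWm (fun i j ω ω' hij => by
      have hle : (i + 1) * b ≤ j * b := Nat.mul_le_mul_right b hij
      rw [add_mul, one_mul] at hle
      have hcr : crossPairs (i * b) b (concat (j * b) ω ω') = crossPairs (i * b) b ω := by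
        refine Finset.sum_congr rfl fun t ht => ?_
        have ht' := Finset.mem_range.1 ht
        congr 1
        refine Finset.filter_congr fun s hs => ?_
        have hs' := Finset.mem_range.1 hs
        rw [pos_concat_of_le (by omega), pos_concat_of_le (by omega)]
      simp only [hW, Set.indicator_apply, Set.mem_ofPred_eq, hcr,
        potentialBound_concat_iff (show i * b ≤ j * b by omega)])
    (ENNReal.ofReal (3 / 2)) (fun j ω => by
      simp only [hW, Set.indicator_apply, Set.mem_ofPred_eq, potentialBound_concat_iff le_rfl]
      by_cases hω : PotentialBound (j * b) K ω
      · simp only [hω, if_true]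
        exact lintegral_exp_crossPairs_le (by positivity)
          (by field_simp; norm_num) _ _ _ hω
      · simp [hω]) b
  calc _ ≤ walkMeasure d {ω | ENNReal.ofReal (Real.exp (8 / b * ((b : ℝ) ^ 2 / 8))) ≤
        ∏ j ∈ Finset.range b, W j ω} := by
        refine measure_mono fun ω hω => ?_
        obtain ⟨h1, h2⟩ := hω
        simp only [Set.mem_ofPred_eq]
        have : ∏ j ∈ Finset.range b, W j ω = ∏ j ∈ Finset.range b,
            ENNReal.ofReal (Real.exp (8 / b * crossPairs (j * b) b ω)) :=
          Finset.prod_congr rfl fun j hj =>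
            Set.indicator_of_mem (s := {ω | PotentialBound (j * b) K ω})
              (h1 j (Finset.mem_range.1 hj)) _
        rw [this, ← ENNReal.ofReal_prod_of_nonneg fun _ _ => (Real.exp_pos _).le, ← Real.exp_sum,
          ← Finset.mul_sum, ← Nat.cast_sum]
        gcongr
    _ ≤ ENNReal.ofReal (Real.exp (-(8 / b * ((b : ℝ) ^ 2 / 8)))) *
        ENNReal.ofReal (Real.exp (1 / 2)) ^ b := by
        refine (measure_ofReal_exp_le_le (Finset.measurable_prod _ fun j _ => hWm j) _).trans ?_
        gcongr
        refine hprod.trans ?_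
        gcongr
        linarith [Real.add_one_le_exp (1 / 2 : ℝ)]
    _ = _ := by
        rw [← ENNReal.ofReal_pow (Real.exp_pos _).le, ← Real.exp_nat_mul,
          ← ENNReal.ofReal_mul (Real.exp_pos _).le, ← Real.exp_add]
        congr 2
        field_simp
        ring

/-! ### The potential of the local times is small -/

/-- The summand `G_d(· - x)` has potential at most `Q = ∑ G_d²` everywhere. The choice `lam = 1 / (4
Q)` makes the potential of `2 F` at most `1 / 2`, so the criterion holds with `a = 2`. -/
theorem measure_sum_green_ge_le [NeZero d] (hfin : ∑' z : Lattice d, green d z ^ 2 ≠ ∞)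
    (x : Lattice d) (n : ℕ) (T : ℝ) :
    walkMeasure d {ω | ENNReal.ofReal T ≤ ∑ k ∈ Finset.range n, green d (pos k ω - x)} ≤
      ENNReal.ofReal (2 * Real.exp (-(T / (4 * (∑' z : Lattice d, green d z ^ 2).toReal)))) := by
  set Q := ∑' z : Lattice d, green d z ^ 2 with hQ
  set s := Q.toReal with hs
  have hs1 : 1 ≤ s := by
    have h := (one_le_green_zero (d := d)).trans (green_le_tsum_sq 0)
    simpa using (ENNReal.toReal_le_toReal ENNReal.one_ne_top hfin).2 h
  set lam : ℝ := 1 / (4 * s) with hlam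
  have hlam0 : 0 < lam := by positivity
  have hlS : ENNReal.ofReal lam * Q = ENNReal.ofReal (1 / 4) := by
    rw [← ENNReal.ofReal_toReal hfin, ← ENNReal.ofReal_mul hlam0.le, ← hs, hlam]
    congr 1
    field_simp
  set F : Lattice d → ℝ≥0∞ := fun z => ENNReal.ofReal lam * green d (z - x) with hF
  have hF1 : ∀ z, F z ≤ 1 := fun z => by
    calc F z ≤ ENNReal.ofReal lam * Q := by
          simp only [hF]
          gcongr
          exact green_le_tsum_sq _
      _ ≤ 1 := by
          rw [hlS]
          exact ENNReal.ofReal_le_one.2 (by norm_num)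
  have hpot : ∀ z, 2 * potential (fun z => 2 * F z) z ≤ 1 := fun z => by
    simp only [hF, potential_const_mul]
    calc _ ≤ 2 * (2 * (ENNReal.ofReal lam * Q)) := by
          gcongr
          exact potential_green_sub_le x z
      _ = 1 := by
          rw [hlS, ← ENNReal.ofReal_ofNat 2, ← ENNReal.ofReal_mul (by norm_num),
            ← ENNReal.ofReal_mul (by norm_num)]
          norm_num
  have hgreen : ∀ z : Lattice d, green d z ≠ ∞ := fun z =>
    ne_top_of_le_ne_top hfin (green_le_tsum_sq z)
  have hm : Measurable fun ω : ℕ → Lattice d =>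
      ∏ k ∈ Finset.range n, (1 + 2 * F (0 + pos k ω)) :=
    Finset.measurable_prod _ fun k _ =>
      (measurable_comp_pos (fun z => 2 * F z) 0 k).const_add 1
  calc _ ≤ walkMeasure d {ω | ENNReal.ofReal (Real.exp (T / (4 * s))) ≤
        ∏ k ∈ Finset.range n, (1 + 2 * F (0 + pos k ω))} := by
        refine measure_mono fun ω hω => ?_
        simp only [Set.mem_ofPred_eq, zero_add] at hω ⊢
        refine le_trans ?_ (ofReal_exp_sum_toReal_le _ _ fun k _ => hF1 (pos k ω))
        refine ENNReal.ofReal_le_ofReal (Real.exp_le_exp.2 ?_)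
        simp only [hF]
        rw [← Finset.mul_sum, ENNReal.toReal_mul, ENNReal.toReal_ofReal hlam0.le]
        have hT : T ≤ (∑ k ∈ Finset.range n, green d (pos k ω - x)).toReal :=
          (ENNReal.ofReal_le_iff_le_toReal
            (ENNReal.sum_ne_top.2 fun k _ => hgreen _)).1 hω
        calc T / (4 * s) = lam * T := by rw [hlam]; ring
          _ ≤ _ := by gcongr
    _ ≤ ENNReal.ofReal (Real.exp (-(T / (4 * s)))) * 2 := by
        refine (measure_ofReal_exp_le_le hm _).trans ?_
        gcongr
        refine (lintegral_prod_one_add_le (fun z => 2 * F z) 2 (fun z _ => ?_) n 0).trans ?_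
        · calc _ ≤ (1 : ℝ≥0∞) + 1 := by gcongr; exact hpot z
            _ = 2 := one_add_one_eq_two
        · calc _ ≤ (1 : ℝ≥0∞) + 1 := by gcongr; exact hpot 0
            _ = 2 := one_add_one_eq_two
    _ = _ := by
        rw [← ENNReal.ofReal_ofNat 2, ← ENNReal.ofReal_mul (Real.exp_pos _).le, mul_comm]

theorem ae_abs_step_le_one [NeZero d] :
    ∀ᵐ ω ∂walkMeasure d, ∀ i j, |ω i j| ≤ 1 := by
  refine ae_all_iff.2 fun i => ?_
  have h : ∀ᵐ v ∂stepLaw d, ∀ j, |v j| ≤ 1 := by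
    have hs : ∀ (i : Fin d) (a : ℤ), |a| ≤ 1 → ∀ j, |(Pi.single i a : Lattice d) j| ≤ 1 := by
      intro i a ha j
      rw [Pi.single_apply]
      split_ifs
      · exact ha
      · simp
    rw [ae_iff]
    simp only [stepLaw, Measure.smul_apply, Measure.finsetSum_apply, Measure.add_apply]
    rw [Finset.sum_eq_zero, smul_zero]
    intro i _
    rw [Measure.dirac_apply' _ (MeasurableSet.of_discrete),
      Measure.dirac_apply' _ (MeasurableSet.of_discrete), Set.indicator_of_notMem,
      Set.indicator_of_notMem, add_zero]
    · simpa using hs i (-1) (by simp)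
    · simpa using hs i 1 (by simp)
  exact (measurePreserving_eval_infinitePi (fun _ : ℕ => stepLaw d) i).quasiMeasurePreserving.ae h

theorem pos_mem_Icc {ω : ℕ → Lattice d} (h : ∀ i j, |ω i j| ≤ 1) {k n : ℕ} (hk : k ≤ n) :
    pos k ω ∈ Finset.Icc (fun _ => -(n : ℤ) : Lattice d) (fun _ => (n : ℤ)) := by
  have hab : ∀ j, |pos k ω j| ≤ n := fun j => by
    rw [pos, Finset.sum_apply]
    calc _ ≤ ∑ i ∈ Finset.range k, |ω i j| := Finset.abs_sum_le_sum_abs _ _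
      _ ≤ ∑ _i ∈ Finset.range k, 1 := Finset.sum_le_sum fun i _ => h i j
      _ ≤ n := by simpa using hk
  rw [Finset.mem_Icc]
  exact ⟨fun j => (abs_le.1 (hab j)).1, fun j => (abs_le.1 (hab j)).2⟩

/-- The random sites `pos i ω` are replaced by a union bound over all sites of the box of radius
`b²`, which almost surely contains the walk up to time `b²`. Extending each sum to that time only
increases it. -/
theorem measure_not_potentialBound_le [NeZero d] (hfin : ∑' z : Lattice d, green d z ^ 2 ≠ ∞)
    (b : ℕ) (T : ℝ) :
    walkMeasure d {ω | ¬ ∀ j < b, PotentialBound (j * b) (ENNReal.ofReal T) ω} ≤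
      ENNReal.ofReal ((2 * (b : ℝ) ^ 2 + 1) ^ d *
        (2 * Real.exp (-(T / (4 * (∑' z : Lattice d, green d z ^ 2).toReal))))) := by
  set B : Finset (Lattice d) :=
    Finset.Icc (fun _ => -((b * b : ℕ) : ℤ)) (fun _ => ((b * b : ℕ) : ℤ)) with hB
  have hcard : B.card = (2 * (b * b) + 1) ^ d := by
    rw [hB, Pi.card_Icc]
    simp only [Int.card_Icc, Finset.prod_const, Finset.card_univ, Fintype.card_fin]
    congr 1
    omega
  calc _ ≤ walkMeasure d (⋃ x ∈ B,
        {ω | ENNReal.ofReal T ≤ ∑ k ∈ Finset.range (b * b), green d (pos k ω - x)}) := by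
        refine measure_mono_ae ?_
        filter_upwards [ae_abs_step_le_one (d := d)] with ω hω hbad
        have hbad' : ¬ ∀ j < b, PotentialBound (j * b) (ENNReal.ofReal T) ω := hbad
        simp only [PotentialBound] at hbad'
        push Not at hbad'
        obtain ⟨j, hj, i, hi, hlt⟩ := hbad'
        have hjb : j * b ≤ b * b := Nat.mul_le_mul_right b hj.le
        refine Set.mem_iUnion₂.2 ⟨pos i ω, pos_mem_Icc hω (hi.trans hjb), ?_⟩
        exact hlt.le.trans (Finset.sum_le_sum_of_subset (Finset.range_subset_range.2 hjb))
    _ ≤ ∑ x ∈ B, walkMeasure d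
        {ω | ENNReal.ofReal T ≤ ∑ k ∈ Finset.range (b * b), green d (pos k ω - x)} :=
        measure_biUnion_finset_le _ _
    _ ≤ ∑ _x ∈ B, ENNReal.ofReal
        (2 * Real.exp (-(T / (4 * (∑' z : Lattice d, green d z ^ 2).toReal)))) :=
        Finset.sum_le_sum fun x _ => measure_sum_green_ge_le hfin x (b * b) T
    _ = _ := by
        rw [Finset.sum_const, nsmul_eq_mul, hcard, ← ENNReal.ofReal_natCast, ← ENNReal.ofReal_mul (by positivity)]
        congr 2
        push_cast
        rw [sq]

/-! ### Counting pairs of times -/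

theorem silt_eq_sum (n : ℕ) (ω : ℕ → Lattice d) :
    silt n ω = ∑ k ∈ Finset.range (n + 1),
      ((Finset.range (n + 1)).filter fun j => pos j ω = pos k ω).card := by
  classical
  rw [Finset.sum_comp (fun x => ((Finset.range (n + 1)).filter fun j => pos j ω = x).card)
    (fun k => pos k ω), silt, finsum_eq_sum_of_support_subset]
  · exact Finset.sum_congr rfl fun x _ => by rw [localTime, sq, smul_eq_mul]
  · intro x hx
    have h : localTime n x ω ≠ 0 := fun h0 => hx (by simp [h0])
    obtain ⟨k, hk⟩ := Finset.card_ne_zero.mp h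
    rw [Finset.mem_filter] at hk
    exact Finset.mem_coe.2 (Finset.mem_image.2 ⟨k, hk.1, hk.2⟩)

/-- By symmetry the square is covered by two copies of a triangle; the diagonal is counted twice,
whence an inequality. -/
theorem sum_range_sum_range_le_two_mul (h : ℕ → ℕ → ℕ) (hsymm : ∀ s t, h s t = h t s) (b : ℕ) :
    ∑ t ∈ Finset.range b, ∑ s ∈ Finset.range b, h s t ≤
      2 * ∑ t ∈ Finset.range b, ∑ s ∈ Finset.range (b - t), h (t + s) t := by
  induction b with
  | zero => simp
  | succ b ih =>
    have hR : ∑ t ∈ Finset.range b, ∑ s ∈ Finset.range (b + 1 - t), h (t + s) t =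
        ∑ t ∈ Finset.range b, ∑ s ∈ Finset.range (b - t), h (t + s) t +
          ∑ t ∈ Finset.range b, h b t := by
      rw [← Finset.sum_add_distrib]
      refine Finset.sum_congr rfl fun t ht => ?_
      have ht' := Finset.mem_range.1 ht
      rw [Nat.sub_add_comm ht'.le, Finset.sum_range_succ, Nat.add_sub_cancel' ht'.le]
    have hS : ∑ s ∈ Finset.range b, h s b = ∑ t ∈ Finset.range b, h b t :=
      Finset.sum_congr rfl fun s _ => hsymm _ _
    have hL : ∑ t ∈ Finset.range b, ∑ s ∈ Finset.range (b + 1), h s t =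
        ∑ t ∈ Finset.range b, ∑ s ∈ Finset.range b, h s t + ∑ t ∈ Finset.range b, h b t := by
      rw [← Finset.sum_add_distrib]
      exact Finset.sum_congr rfl fun t _ => Finset.sum_range_succ _ _
    rw [Finset.sum_range_succ, hL, Finset.sum_range_succ (fun s => h s b),
      Finset.sum_range_succ (fun t => ∑ s ∈ Finset.range (b + 1 - t), h (t + s) t), hR, hS]
    simp only [Nat.add_sub_cancel_left, Finset.sum_range_one, add_zero]
    omega

/-- Adding block `N` enlarges the square of time pairs by the square of that block and by two
mirror-image rectangles, each counted by `crossPairs`. -/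
theorem sum_card_filter_pos_le (b N : ℕ) (ω : ℕ → Lattice d) :
    ∑ k ∈ Finset.range (N * b),
        ((Finset.range (N * b)).filter fun j => pos j ω = pos k ω).card ≤
      2 * (∑ j ∈ Finset.range N, blockPairs b j ω +
        ∑ j ∈ Finset.range N, crossPairs (j * b) b ω) := by
  induction N with
  | zero => simp
  | succ N ih =>
    simp only [Finset.card_filter] at ih ⊢
    set m := N * b with hm
    set e : ℕ → ℕ → ℕ := fun j k => if pos j ω = pos k ω then 1 else 0 with he
    have hes : ∀ j k, e j k = e k j := fun j k => by simp only [he, eq_comm]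
    have h1 : crossPairs m b ω = ∑ t ∈ Finset.range b, ∑ j ∈ Finset.range m, e j (m + t) := by
      simp only [crossPairs, Finset.card_filter, he]
    have h2 : blockPairs b N ω =
        ∑ t ∈ Finset.range b, ∑ s ∈ Finset.range (b - t), e (m + (t + s)) (m + t) := by
      simp only [blockPairs, Finset.card_filter, he, hm]
    have h3 := sum_range_sum_range_le_two_mul (fun s t => e (m + s) (m + t))
      (fun s t => hes _ _) b
    have h4 : ∑ k ∈ Finset.range m, ∑ t ∈ Finset.range b, e (m + t) k = crossPairs m b ω := by
      rw [h1, Finset.sum_comm]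
      exact Finset.sum_congr rfl fun t _ => Finset.sum_congr rfl fun k _ => hes _ _
    rw [show (N + 1) * b = m + b by rw [hm]; ring, Finset.sum_range_succ _ N,
      Finset.sum_range_succ _ N, ← hm]
    change ∑ k ∈ Finset.range (m + b), ∑ j ∈ Finset.range (m + b), e j k ≤ _
    simp_rw [Finset.sum_range_add _ m b, Finset.sum_add_distrib]
    rw [h4, ← h1, h2]
    change ∑ k ∈ Finset.range m, ∑ j ∈ Finset.range m, e j k ≤ _ at ih
    omega

/-! ### The upper bound -/

theorem exists_measure_silt_ge_le [NeZero d] (hfin : ∑' z : Lattice d, green d z ^ 2 ≠ ∞) :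
    ∃ c K : ℝ, 0 < c ∧ ∀ b n : ℕ, n + 1 ≤ b * b → ∀ T : ℝ,
      (2 * (green d 0).toReal + 1 / 2) * (b : ℝ) ^ 2 ≤ T →
      (walkMeasure d).real {ω | T ≤ (silt n ω : ℝ)} ≤
        K * (b : ℝ) ^ (2 * d) * Real.exp (-(c * b)) := by
  have hg : green d 0 ≠ ∞ := ne_top_of_le_ne_top hfin (green_le_tsum_sq 0)
  obtain ⟨c, hc0, hc⟩ := exists_measure_sum_blockPairs_le hg
  set s := (∑' z : Lattice d, green d z ^ 2).toReal with hs
  have hs1 : 1 ≤ s := by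
    have h := (one_le_green_zero (d := d)).trans (green_le_tsum_sq 0)
    simpa using (ENNReal.toReal_le_toReal ENNReal.one_ne_top hfin).2 h
  -- The three rates belong to the bad events `A`, `B`, `C` below; `256 = 64 * 4` comes from the
  -- level `b / 64` in the tail `exp(-T / (4 s))`.
  set c' := min c (min (1 / 2) (1 / (256 * s))) with hc'
  have hc'1 : c' ≤ c := min_le_left _ _
  have hc'2 : c' ≤ 1 / 2 := (min_le_right _ _).trans (min_le_left _ _)
  have hc'3 : c' ≤ 1 / (256 * s) := (min_le_right _ _).trans (min_le_right _ _)
  refine ⟨c', 2 + 2 * 3 ^ d, lt_min hc0 (lt_min (by norm_num) (by positivity)), ?_⟩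
  intro b n hbn T hT
  have hb : 0 < b := by
    rcases Nat.eq_zero_or_pos b with h | h
    · simp [h] at hbn
    · exact h
  have hb1 : (1 : ℝ) ≤ b := by exact_mod_cast hb
  set G := (green d 0).toReal
  set A := {ω : ℕ → Lattice d | (G + 1 / 8) * (b : ℝ) ^ 2 ≤
    ((∑ j ∈ Finset.range b, blockPairs b j ω : ℕ) : ℝ)} with hA
  set B := {ω : ℕ → Lattice d | (∀ j < b, PotentialBound (j * b) (ENNReal.ofReal (b / 64)) ω) ∧
    (b : ℝ) ^ 2 / 8 ≤ ((∑ j ∈ Finset.range b, crossPairs (j * b) b ω : ℕ) : ℝ)} with hB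
  set C := {ω : ℕ → Lattice d | ¬ ∀ j < b, PotentialBound (j * b) (ENNReal.ofReal (b / 64)) ω}
    with hC
  -- Outside the bad events, `silt` is below `2 ((G + 1 / 8) + 1 / 8) b² = (2 G + 1 / 2) b²`.
  have hsub : {ω : ℕ → Lattice d | T ≤ (silt n ω : ℝ)} ⊆ A ∪ B ∪ C := by
    intro ω hω
    by_contra hcon
    simp only [Set.mem_union, not_or, hA, hB, hC, Set.mem_ofPred_eq, not_le, not_not,
      not_and] at hcon hω
    obtain ⟨⟨h1, h2⟩, h3⟩ := hcon
    have h2' := h2 h3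
    have h4 : silt n ω ≤ 2 * (∑ j ∈ Finset.range b, blockPairs b j ω +
        ∑ j ∈ Finset.range b, crossPairs (j * b) b ω) := by
      refine le_trans ?_ (sum_card_filter_pos_le b b ω)
      rw [silt_eq_sum]
      have hr : Finset.range (n + 1) ⊆ Finset.range (b * b) := Finset.range_subset_range.2 hbn
      exact (Finset.sum_le_sum fun k _ => Finset.card_le_card (Finset.filter_subset_filter _ hr)).trans
        (Finset.sum_le_sum_of_subset hr)
    have h5 : (silt n ω : ℝ) ≤ 2 * (((∑ j ∈ Finset.range b, blockPairs b j ω : ℕ) : ℝ) +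
        ((∑ j ∈ Finset.range b, crossPairs (j * b) b ω : ℕ) : ℝ)) := by exact_mod_cast h4
    linarith
  have hexp : ∀ t : ℝ, c' * b ≤ t → Real.exp (-t) ≤ Real.exp (-(c' * b)) := fun t ht =>
    Real.exp_le_exp.2 (neg_le_neg ht)
  have hpoly : (2 * (b : ℝ) ^ 2 + 1) ^ d ≤ 3 ^ d * (b : ℝ) ^ (2 * d) := by
    rw [pow_mul, ← mul_pow]
    gcongr
    nlinarith
  have hone : (1 : ℝ) ≤ (b : ℝ) ^ (2 * d) := one_le_pow₀ hb1
  refine ENNReal.toReal_le_of_le_ofReal (by positivity) ?_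
  calc _ ≤ walkMeasure d A + walkMeasure d B + walkMeasure d C :=
        (measure_mono hsub).trans ((measure_union_le _ _).trans
          (add_le_add_left (measure_union_le _ _) _))
    _ ≤ ENNReal.ofReal (Real.exp (-(c * b))) + ENNReal.ofReal (Real.exp (-(1 / 2 * b))) +
        ENNReal.ofReal ((2 * (b : ℝ) ^ 2 + 1) ^ d *
          (2 * Real.exp (-((b : ℝ) / 64 / (4 * s))))) :=
        add_le_add (add_le_add (hc b hb) (measure_sum_crossPairs_le hb))
          (measure_not_potentialBound_le hfin b _)
    _ ≤ _ := by
        rw [← ENNReal.ofReal_add (by positivity) (by positivity),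
          ← ENNReal.ofReal_add (by positivity) (by positivity)]
        refine ENNReal.ofReal_le_ofReal ?_
        have e1 := hexp (c * b) (by gcongr)
        have e2 := hexp (1 / 2 * b) (by gcongr)
        have e3 := hexp ((b : ℝ) / 64 / (4 * s)) (by
          calc c' * b ≤ 1 / (256 * s) * b := by gcongr
            _ = _ := by field_simp; norm_num)
        have e0 := Real.exp_pos (-(c' * b))
        calc _ ≤ Real.exp (-(c' * b)) + Real.exp (-(c' * b)) +
              3 ^ d * (b : ℝ) ^ (2 * d) * (2 * Real.exp (-(c' * b))) := by gcongr
          _ ≤ _ := by nlinarith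

/-- With `b = ⌊√n⌋ + 1`, the gap between `2 G + 1 / 2` and `2 G + 1` absorbs the difference between
`b²` and `(b - 1)² ≤ n` for large `b`. Half of the exponential rate absorbs the polynomial
prefactor. -/
theorem exists_eventually_measure_silt_ge_le [NeZero d]
    (hfin : ∑' z : Lattice d, green d z ^ 2 ≠ ∞) {y : ℝ} (hy : 1 + 2 * (green d 0).toReal < y) :
    ∃ c : ℝ, 0 < c ∧ ∀ᶠ n : ℕ in atTop,
      (walkMeasure d).real {ω | (n : ℝ) * y ≤ (silt n ω : ℝ)} ≤ Real.exp (-c * Real.sqrt n) := by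
  obtain ⟨c, K, hc0, hc⟩ := exists_measure_silt_ge_le hfin
  set G := (green d 0).toReal with hG
  have hG0 : 0 ≤ G := ENNReal.toReal_nonneg
  refine ⟨c / 2, by positivity, ?_⟩
  have hblim : Tendsto (fun n : ℕ => n.sqrt + 1) atTop atTop := by
    refine tendsto_atTop_mono (fun n => Nat.le_succ _) ?_
    refine tendsto_atTop.2 fun m => ?_
    filter_upwards [eventually_ge_atTop (m * m)] with n hn
    exact Nat.le_sqrt.2 hn
  have hlim : Tendsto (fun b : ℕ => K * (b : ℝ) ^ (2 * d) * Real.exp (-(c / 2 * b))) atTop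
      (nhds 0) := by
    have h := (Real.tendsto_pow_mul_exp_neg_atTop_nhds_zero (2 * d)).comp
      ((tendsto_natCast_atTop_atTop (R := ℝ)).const_mul_atTop (by positivity : 0 < c / 2))
    have h' := h.const_mul (K / (c / 2) ^ (2 * d))
    rw [mul_zero] at h'
    refine h'.congr fun b => ?_
    simp only [Function.comp, mul_pow]
    field_simp
  have hev := hblim.eventually (hlim.eventually (gt_mem_nhds (zero_lt_one' ℝ)))
  filter_upwards [hev, hblim.eventually_ge_atTop (8 * ⌈2 * G + 1⌉₊ + 8)] with n h1 h2
  set b := n.sqrt + 1 with hb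
  have hbn : n + 1 ≤ b * b := Nat.lt_succ_sqrt n
  have hbn' : n.sqrt * n.sqrt ≤ n := Nat.sqrt_le n
  have hsb : (n.sqrt : ℝ) = b - 1 := by rw [hb]; push_cast; ring
  have hbR : ((b : ℝ) - 1) * (b - 1) ≤ n := by rw [← hsb]; exact_mod_cast hbn'
  have hbig : 8 * (2 * G + 1) ≤ b := by
    have : (8 * ⌈2 * G + 1⌉₊ + 8 : ℝ) ≤ b := by exact_mod_cast h2
    linarith [Nat.le_ceil (2 * G + 1)]
  have hT : (2 * G + 1 / 2) * (b : ℝ) ^ 2 ≤ n * y := by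
    calc _ ≤ ((b : ℝ) - 1) * (b - 1) * (1 + 2 * G) := by nlinarith
      _ ≤ n * y := by gcongr
  have hsqrt : Real.sqrt n ≤ b := by
    refine Real.sqrt_le_iff.2 ⟨by positivity, ?_⟩
    have : (n + 1 : ℝ) ≤ b * b := by exact_mod_cast hbn
    nlinarith
  calc _ ≤ K * (b : ℝ) ^ (2 * d) * Real.exp (-(c * b)) := hc b n hbn _ hT
    _ = K * (b : ℝ) ^ (2 * d) * Real.exp (-(c / 2 * b)) * Real.exp (-(c / 2 * b)) := by
        rw [mul_assoc _ (Real.exp _), ← Real.exp_add]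
        congr 2
        ring
    _ ≤ 1 * Real.exp (-(c / 2 * b)) := by gcongr
    _ ≤ _ := by
        rw [one_mul]
        refine Real.exp_le_exp.2 ?_
        nlinarith

/-! ### Prescribed paths -/

theorem le_stepLaw_singleton (i : Fin d) {a : ℤ} (ha : a = 1 ∨ a = -1) :
    (2 * (d : ℝ≥0∞))⁻¹ ≤ stepLaw d {Pi.single i a} := by
  simp only [stepLaw, Measure.smul_apply, Measure.finsetSum_apply, Measure.add_apply, smul_eq_mul]
  refine le_mul_of_one_le_right zero_le ?_
  refine le_trans ?_ (Finset.single_le_sum (f := fun i : Fin d =>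
    Measure.dirac (Pi.single i (1 : ℤ)) {(Pi.single _ a : Lattice d)} +
      Measure.dirac (Pi.single i (-1 : ℤ)) {(Pi.single _ a : Lattice d)})
    (fun _ _ => zero_le) (Finset.mem_univ i))
  rcases ha with rfl | rfl
  · exact le_trans (by simp) le_self_add
  · exact le_trans (by simp) le_add_self

theorem le_measure_steps_eq [NeZero d] (v : ℕ → Lattice d)
    (hv : ∀ i, (2 * (d : ℝ≥0∞))⁻¹ ≤ stepLaw d {v i}) (m : ℕ) :
    (2 * (d : ℝ))⁻¹ ^ m ≤ (walkMeasure d).real {ω | ∀ i < m, ω i = v i} := by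
  have hset : {ω : ℕ → Lattice d | ∀ i < m, ω i = v i} =
      ((Finset.range m : Finset ℕ) : Set ℕ).pi fun i => {v i} := by
    ext ω
    simp [Set.mem_pi]
  rw [hset, measureReal_def, walkMeasure,
    Measure.infinitePi_pi _ fun i _ => MeasurableSet.singleton _]
  rw [ENNReal.toReal_prod, ← Finset.card_range m, ← Finset.prod_const, Finset.card_range]
  refine Finset.prod_le_prod (fun _ _ => by positivity) fun i _ => ?_
  have h := ENNReal.toReal_mono (measure_ne_top (stepLaw d) _) (hv i)
  simpa using h

/-- The straight path has positive probability and visits each site once, giving `silt n = n + 1 ≤ 2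
n < n y`. This strictness lets the upper bound reach small `n`. -/
theorem measure_silt_ge_lt_one [NeZero d] {y : ℝ} (hy : 2 < y) {n : ℕ} (hn : 1 ≤ n) :
    (walkMeasure d).real {ω | (n : ℝ) * y ≤ (silt n ω : ℝ)} < 1 := by
  set e : Lattice d := Pi.single 0 1 with he
  set S := {ω : ℕ → Lattice d | ∀ i < n, ω i = e} with hS
  have hSm : MeasurableSet S := by
    simp only [hS, Set.ofPred_forall]
    exact MeasurableSet.iInter fun i => MeasurableSet.iInter fun _ =>
      measurableSet_eq_fun (measurable_pi_apply i) measurable_const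
  have hd0 : (0 : ℝ) < d := by exact_mod_cast Nat.pos_of_ne_zero (NeZero.ne d)
  have hpos : 0 < (walkMeasure d).real S :=
    lt_of_lt_of_le (by positivity)
      (le_measure_steps_eq (fun _ => e) (fun _ => le_stepLaw_singleton 0 (Or.inl rfl)) n)
  have hsub : {ω : ℕ → Lattice d | (n : ℝ) * y ≤ (silt n ω : ℝ)} ⊆ Sᶜ := by
    intro ω hω hωS
    have hp : ∀ k ≤ n, pos k ω 0 = k := fun k hk => by
      rw [pos, Finset.sum_apply, Finset.sum_congr rfl fun i hi => by
        rw [hωS i ((Finset.mem_range.1 hi).trans_le hk)]]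
      simp [he]
    have hsilt : silt n ω = n + 1 := by
      rw [silt_eq_sum, Finset.sum_congr rfl (g := fun _ => 1), Finset.sum_const, Finset.card_range,
        smul_eq_mul, mul_one]
      intro k hk
      rw [Finset.card_eq_one]
      refine ⟨k, Finset.eq_singleton_iff_unique_mem.2 ⟨Finset.mem_filter.2 ⟨hk, rfl⟩, ?_⟩⟩
      intro j hj
      obtain ⟨hj1, hj2⟩ := Finset.mem_filter.1 hj
      have h1 := hp j (Nat.lt_succ_iff.1 (Finset.mem_range.1 hj1))
      have h2 := hp k (Nat.lt_succ_iff.1 (Finset.mem_range.1 hk))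
      rw [hj2, h2] at h1
      exact_mod_cast h1.symm
    have hω' : (n : ℝ) * y ≤ (silt n ω : ℝ) := hω
    rw [hsilt] at hω'
    push_cast at hω'
    have : (1 : ℝ) ≤ n := by exact_mod_cast hn
    nlinarith
  calc _ ≤ (walkMeasure d).real Sᶜ := measureReal_mono hsub
    _ = 1 - (walkMeasure d).real S := by rw [measureReal_compl hSm]; simp
    _ < 1 := by linarith

theorem eventually_le_measure_silt_ge [NeZero d] {y : ℝ} (hy : 0 < y) :
    ∃ c : ℝ, 0 < c ∧ ∀ᶠ n : ℕ in atTop, Real.exp (-c * Real.sqrt n) ≤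
      (walkMeasure d).real {ω | (n : ℝ) * y ≤ (silt n ω : ℝ)} := by
  have hd1 : (1 : ℝ) ≤ d := by exact_mod_cast Nat.pos_of_ne_zero (NeZero.ne d)
  have hlog : 0 < Real.log (2 * d) := Real.log_pos (by linarith)
  refine ⟨2 * (Real.sqrt y + 1) * Real.log (2 * d), by positivity, ?_⟩
  have hsq : Tendsto (fun n : ℕ => Real.sqrt n) atTop atTop :=
    Real.tendsto_sqrt_atTop.comp tendsto_natCast_atTop_atTop
  filter_upwards [hsq.eventually_ge_atTop (2 * (Real.sqrt y + 1)), eventually_ge_atTop 1]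
    with n hn hn1
  have hn1' : 1 ≤ Real.sqrt n := Real.one_le_sqrt.2 (by exact_mod_cast hn1)
  -- `r` visits to the origin give `r² ≥ n y`. The path prescribes `2 r ≤ 2 (√y + 1) √n` steps, each
  -- costing a factor `2 d`, which yields the constant.
  set r := ⌈Real.sqrt y * Real.sqrt n⌉₊ with hr
  have hr1 : Real.sqrt y * Real.sqrt n ≤ r := Nat.le_ceil _
  have hr2 : (r : ℝ) ≤ (Real.sqrt y + 1) * Real.sqrt n := by
    linarith [Nat.ceil_lt_add_one (by positivity : 0 ≤ Real.sqrt y * Real.sqrt n)]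
  have hnn : Real.sqrt n * Real.sqrt n = n := Real.mul_self_sqrt (by positivity)
  have hyy : Real.sqrt y * Real.sqrt y = y := Real.mul_self_sqrt hy.le
  have h2r : 2 * r ≤ n := by
    have : (2 * r : ℝ) ≤ n := by nlinarith
    exact_mod_cast this
  set v : ℕ → Lattice d := fun i => Pi.single 0 (if Even i then 1 else -1) with hv
  have hmeas := le_measure_steps_eq v (fun i => le_stepLaw_singleton 0 (by
    by_cases h : Even i <;> simp [h])) (2 * r)
  have hsub : {ω : ℕ → Lattice d | ∀ i < 2 * r, ω i = v i} ⊆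
      {ω | (n : ℝ) * y ≤ (silt n ω : ℝ)} := by
    intro ω hω
    have hp : ∀ k ≤ r, pos (2 * k) ω = 0 := fun k hk => by
      induction k with
      | zero => exact pos_zero ω
      | succ k ih =>
        have h1 : ω (2 * k) = Pi.single 0 1 := by rw [hω _ (by omega)]; simp [hv]
        have h2 : ω (2 * k + 1) = Pi.single 0 (-1) := by
          rw [hω _ (by omega)]
          simp [hv]
        have h3 := ih (by omega)
        rw [pos] at h3 ⊢
        rw [show 2 * (k + 1) = 2 * k + 1 + 1 by ring, Finset.sum_range_succ, Finset.sum_range_succ,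
          h3, h1, h2, zero_add, ← Pi.single_add]
        simp
    have hloc : r ≤ localTime n 0 ω := by
      calc r = ((Finset.range r).image (2 * ·)).card := by
            rw [Finset.card_image_of_injective _ fun a b h => by simpa using h, Finset.card_range]
        _ ≤ _ := by
            refine Finset.card_le_card fun k hk => ?_
            obtain ⟨j, hj, rfl⟩ := Finset.mem_image.1 hk
            have hj' := Finset.mem_range.1 hj
            exact Finset.mem_filter.2 ⟨Finset.mem_range.2 (by omega), hp j hj'.le⟩
    have hsilt : r ^ 2 ≤ silt n ω := by
      calc r ^ 2 ≤ localTime n 0 ω ^ 2 := by gcongr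
        _ ≤ silt n ω := single_le_finsum (0 : Lattice d) (finite_support_localTime_sq n ω)
            fun _ => Nat.zero_le _
    have hsilt' : (r : ℝ) ^ 2 ≤ silt n ω := by exact_mod_cast hsilt
    refine le_trans ?_ hsilt'
    calc (n : ℝ) * y = (Real.sqrt y * Real.sqrt n) ^ 2 := by rw [mul_pow, sq, sq, hnn, hyy]; ring
      _ ≤ (r : ℝ) ^ 2 := by gcongr
  calc _ ≤ (2 * (d : ℝ))⁻¹ ^ (2 * r) := by
        rw [← Real.exp_log (by positivity : (0 : ℝ) < (2 * (d : ℝ))⁻¹), ← Real.exp_nat_mul, Real.log_inv]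
        refine Real.exp_le_exp.2 ?_
        push_cast
        nlinarith
    _ ≤ _ := hmeas.trans (measureReal_mono hsub)

/-! ### From large `n` to every `n` -/

theorem exists_forall_le_exp_neg_mul_sqrt {p : ℕ → ℝ} (h0 : p 0 ≤ 1) (h1 : ∀ n, 1 ≤ n → p n < 1)
    {c : ℝ} (hc : 0 < c) (hev : ∀ᶠ n : ℕ in atTop, p n ≤ Real.exp (-c * Real.sqrt n)) :
    ∃ c' : ℝ, 0 < c' ∧ ∀ n, p n ≤ Real.exp (-c' * Real.sqrt n) := by
  obtain ⟨N, hN⟩ := eventually_atTop.1 hev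
  -- Each remaining `n ≥ 1` admits a small constant because `p n < 1`, and finitely many constants
  -- have a positive minimum. At `n = 0` the right side is `1`, so any constant works.
  have hfin : ∀ M : ℕ, ∃ c' : ℝ, 0 < c' ∧ ∀ n < M, p n ≤ Real.exp (-c' * Real.sqrt n) := by
    intro M
    induction M with
    | zero => exact ⟨1, one_pos, fun n hn => absurd hn (Nat.not_lt_zero n)⟩
    | succ M ih =>
      obtain ⟨c₁, hc₁, h₁⟩ := ih
      obtain ⟨c₂, hc₂, h₂⟩ : ∃ c₂ : ℝ, 0 < c₂ ∧ p M ≤ Real.exp (-c₂ * Real.sqrt M) := by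
        have hlim : Tendsto (fun t : ℝ => Real.exp (-t * Real.sqrt M)) (nhdsWithin 0 (Set.Ioi 0))
            (nhds 1) := by
          have hcont : Continuous fun t : ℝ => Real.exp (-t * Real.sqrt M) := by fun_prop
          have := hcont.tendsto 0
          simp only [neg_zero, zero_mul, Real.exp_zero] at this
          exact this.mono_left nhdsWithin_le_nhds
        rcases Nat.eq_zero_or_pos M with rfl | hM
        · exact ⟨1, one_pos, by simpa using h0⟩
        · obtain ⟨t, ht, ht0⟩ := ((hlim.eventually (lt_mem_nhds (h1 M hM))).and
            self_mem_nhdsWithin).exists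
          exact ⟨t, ht0, ht.le⟩
      refine ⟨min c₁ c₂, lt_min hc₁ hc₂, fun n hn => ?_⟩
      rcases Nat.lt_succ_iff_lt_or_eq.1 hn with h | rfl
      · refine (h₁ n h).trans (Real.exp_le_exp.2 ?_)
        have := min_le_left c₁ c₂
        gcongr
      · refine h₂.trans (Real.exp_le_exp.2 ?_)
        have := min_le_right c₁ c₂
        gcongr
  obtain ⟨c₁, hc₁, h₁⟩ := hfin N
  refine ⟨min c₁ c, lt_min hc₁ hc, fun n => ?_⟩
  rcases lt_or_ge n N with h | h
  · refine (h₁ n h).trans (Real.exp_le_exp.2 ?_)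
    have := min_le_left c₁ c
    gcongr
  · refine (hN n h).trans (Real.exp_le_exp.2 ?_)
    have := min_le_right c₁ c
    gcongr

end

end SRW

theorem proposition1p3 (d : ℕ) (hd : 5 ≤ d) (y : ℝ)
    (hy : 1 + 2 * ∑' x : SRW.Lattice d, SRW.green d x ^ 2 < ENNReal.ofReal y) :
    ∃ cUpper cLower : ℝ, 0 < cUpper ∧ 0 < cLower ∧
      (∀ n : ℕ,
        (SRW.walkMeasure d).real {ω | (n : ℝ) * y ≤ (SRW.silt n ω : ℝ)} ≤
          Real.exp (-cUpper * Real.sqrt n)) ∧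
      (∀ᶠ n : ℕ in atTop,
        Real.exp (-cLower * Real.sqrt n) ≤
          (SRW.walkMeasure d).real {ω | (n : ℝ) * y ≤ (SRW.silt n ω : ℝ)}) := by
  have : NeZero d := ⟨by omega⟩
  -- An infinite sum would make the left side of `hy` infinite, while `ENNReal.ofReal y` is finite.
  have hfin : ∑' x : SRW.Lattice d, SRW.green d x ^ 2 ≠ ∞ := by
    intro h
    simp [h] at hy
  have hgs := SRW.green_le_tsum_sq (0 : SRW.Lattice d)
  have hg : SRW.green d 0 ≠ ∞ := ne_top_of_le_ne_top hfin hgs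
  -- The level enters the upper bound only through this weaker threshold, which follows from `G_d(0)
  -- ≤ ∑ G_d²`; together with `G_d(0) ≥ 1` it gives `y > 3`.
  have hG : 1 + 2 * (SRW.green d 0).toReal < y := by
    have h : 1 + 2 * SRW.green d 0 < ENNReal.ofReal y := lt_of_le_of_lt (by gcongr) hy
    rw [ENNReal.lt_ofReal_iff_toReal_lt (by finiteness),
      ENNReal.toReal_add (by simp) (by finiteness), ENNReal.toReal_mul] at h
    simpa using h
  have hG1 : 1 ≤ (SRW.green d 0).toReal := by
    simpa using (ENNReal.toReal_le_toReal ENNReal.one_ne_top hg).2 SRW.one_le_green_zero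
  obtain ⟨c, hc, hev⟩ := SRW.exists_eventually_measure_silt_ge_le hfin hG
  obtain ⟨cU, hcU, hU⟩ := SRW.exists_forall_le_exp_neg_mul_sqrt measureReal_le_one
    (fun n hn => SRW.measure_silt_ge_lt_one (d := d) (by linarith : 2 < y) hn) hc hev
  obtain ⟨cL, hcL, hL⟩ := SRW.eventually_le_measure_silt_ge (d := d) (by linarith : 0 < y)
  exact ⟨cU, cL, hcU, hcL, hU, hL⟩
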